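/- **Theorem (No AIXI is computable).** *Setting.* Let $\mathcal A$ be a finite set of at least two actions and $\mathcal E$ a finite set of percepts, where each percept $e$ carries a reward $r(e)\in[0,1]$; assume that some percept has reward $0$ and some percept has positive reward. A history is a finite sequence $æ_{1:t}=a_1e_1\dots a_te_t$ of actions and percepts; a policy $\pi$ maps histories to actions. A *chronological conditional semimeasure* is a function $\nu(e_{1:t}\,\|\,a_{1:t})\ge 0$ with $\nu(\epsilon)\le1$ and $\sum_{e\in\mathcal E}\nu(e_{1:t}e\,\|\,a_{1:t}a)\le\nu(e_{1:t}\,\|\,a_{1:t})$ for every action $a$. A real-valued function $f$ is *lower semicomputable* if $\{(x,q): q\in\mathbb Q,\ q<f(x)\}$ is recursively enumerable. Let $\mathcal M$ be the class of all lower semicomputable chronological conditional semimeasures. *Universal mixture.* Let $\xi$ be a universal mixture, that is, either * $\xi(e_{1:t}\,\|\,a_{1:t})$ is the probability that $U$, given the actions $a_{1:t}$ and independent uniformly random bits as program, produces an output that starts with $e_{1:t}$, where $U$ is a universal chronological monotone Turing machine (for every chronological monotone machine $T$ there is a string $c$ with $U(cp,a)=T(p,a)$ for all $p$ and $a$; *chronological*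 means that the $k$-th percept is written after the $k$-th action and before the $(k+1)$-st action is read); or * $\xi=\sum_{\nu\in\mathcal M}w_\nu\,\nu$ for some weights $w_\nu>0$ with $\sum_{\nu\in\mathcal M}w_\nu\le1$ (in particular, those given by a universal Turing machine). *Values and optimal policies.* For $\gamma:\mathbb N\to[0,\infty)$ with $\sum_t\gamma_t<\infty$ let $\Gamma_t=\sum_{i\ge t}\gamma_i$ and $$V^{\pi}_{\nu,\gamma}(æ_{<t})=\frac1{\Gamma_t}\lim_{m\to\infty}\sum_{e_{t:m}}\Big(\sum_{k=t}^m\gamma_k\,r(e_k)\Big)\frac{\nu(e_{1:m}\,\|\,a_{1:m})}{\nu(e_{<t}\,\|\,a_{<t})},$$ where $a_i=\pi(æ_{<i})$ for $i\ge t$, and $V^{\pi}_{\nu,\gamma}(æ_{<t})=0$ if $\Gamma_t=0$. A policy $\pi$ is *optimal* (for $\nu$ and $\gamma$) if $V^{\pi}_{\nu,\gamma}(h)=\sup_{\pi'}V^{\pi'}_{\nu,\gamma}(h)$ for every history $h$. For $m\in\mathbb N$ let $\gamma_{\mathrm{LT}m}(t)=1$ for $t\le m$ and $\gamma_{\mathrm{LT}m}(t)=0$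 for $t>m$. *Conclusion.* 1. (Finite lifetime.) There is no computable function $(m,h)\mapsto\pi_m(h)$ such that for every $m$ the policy $\pi_m$ is optimal for $\xi$ and $\gamma_{\mathrm{LT}m}$. The same holds if, in the value for lifetime $m$, the limit over the summation horizon is replaced by the sum over $e_{t:m}$ that stops at the lifetime $m$. 2. (Discounting.) For every lower semicomputable $\gamma:\mathbb N\to[0,\infty)$ with $\sum_t\gamma_t<\infty$ and $\Gamma_t>0$ for all $t$, no policy that is optimal for $\xi$ and $\gamma$ is computable. -/

import Mathlib

open MeasureTheory Filter

noncomputable section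

namespace AIXI

/-- A history `æ_{1:t}`: the list of the pairs (action, percept), oldest first. -/
abbrev History (A E : Type*) := List (A × E)

/-- A policy maps a history to the next action. -/
abbrev Policy (A E : Type*) := History A E → A

/-- The rational number with code `(a, b, c)`, namely `(a - b) / (c + 1)`;
every rational number has such a code. -/
def ratOfCode (q : ℕ × ℕ × ℕ) : ℚ := ((q.1 : ℚ) - q.2.1) / (q.2.2 + 1)

/-- `f` is lower semicomputable: the set of the pairs `(x, q)`, `q` rational, with `q < f x`
is recursively enumerable. -/
def LowerSemicomputable {α : Type*} [Primcodable α] (f : α → ℝ) : Prop :=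
  REPred fun x : α × (ℕ × ℕ × ℕ) => (ratOfCode x.2 : ℝ) < f x.1

section Environments

variable {A E : Type*}

/-- A chronological conditional semimeasure `ν(e_{1:t} ‖ a_{1:t})`, written as a function of the
history `æ_{1:t}` (so that it cannot depend on later actions): it has nonnegative values,
`ν(ε) ≤ 1`, and `∑_e ν(e_{1:t} e ‖ a_{1:t} a) ≤ ν(e_{1:t} ‖ a_{1:t})` for every next
action `a`. -/
structure IsChronologicalSemimeasure [Fintype E] (ν : History A E → ℝ) : Prop where
  nonneg : ∀ h, 0 ≤ ν h
  nil_le_one : ν [] ≤ 1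
  sum_le : ∀ h a, ∑ e, ν (h ++ [(a, e)]) ≤ ν h

variable (A E) in
/-- The environment class: all lower semicomputable chronological conditional semimeasures. -/
def environmentClass [Primcodable A] [Fintype E] [Primcodable E] : Set (History A E → ℝ) :=
  {ν | IsChronologicalSemimeasure ν ∧ LowerSemicomputable ν}

/-- A prior on the environment class that gives positive weight to every environment. -/
structure IsUniversalPrior [Primcodable A] [Fintype E] [Primcodable E]
    (w : environmentClass A E → ℝ) : Prop where
  pos : ∀ ν, 0 < w ν
  summable : Summable w
  tsum_le_one : ∑' ν, w ν ≤ 1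

/-- The mixture `∑_ν w_ν ν` over the environment class. -/
def mixture [Primcodable A] [Fintype E] [Primcodable E]
    (w : environmentClass A E → ℝ) (h : History A E) : ℝ :=
  ∑' ν : environmentClass A E, w ν * (ν : History A E → ℝ) h

end Environments

section Machines

variable {A E : Type*} [Primcodable A] [Primcodable E]

/-- A chronological monotone Turing machine. `run p a n` is the list of the percepts that the
machine has written on its one-way output tape after `n` steps if its one-way input tape holds
the bits `p` and the actions that it has been given so far are `a` (it waits when it needs a bit
or an action that is not yet there). Written output is never revised, and the `k`-th percept is
written after the `k`-th action and before the `(k+1)`-st action is read. -/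
structure MonotoneMachine (A E : Type*) [Primcodable A] [Primcodable E] where
  run : List Bool → List A → ℕ → List E
  computable_run : Computable fun x : List Bool × List A × ℕ => run x.1 x.2.1 x.2.2
  monotone : ∀ {p p' : List Bool} (a : List A) {n n' : ℕ},
    p <+: p' → n ≤ n' → run p a n <+: run p' a n'
  chronological : ∀ (p : List Bool) (a : List A) (n k : ℕ),
    run p (a.take k) n = (run p a n).take k

/-- `e ⊑ T(p, a)`: on the program `p` and the actions `a` the output of `T` starts with `e`. -/
def MonotoneMachine.Outputs (T : MonotoneMachine A E)
    (p : List Bool) (a : List A) (e : List E) : Prop :=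
  ∃ n, e <+: T.run p a n

/-- `U` is universal: it simulates every machine `T` through some prefix `c` of its program,
`U(c p, a) = T(p, a)`. -/
def MonotoneMachine.IsUniversal (U : MonotoneMachine A E) : Prop :=
  ∀ T : MonotoneMachine A E, ∃ c : List Bool, ∀ p a e,
    U.Outputs (c ++ p) a e ↔ T.Outputs p a e

/-- The law of an infinite sequence of independent uniformly random bits. -/
def coinFlips : Measure (ℕ → Bool) :=
  Measure.infinitePi fun _ => (PMF.uniformOfFintype Bool).toMeasure

/-- The universal mixture of the machine `U`, `ξ_U(e_{1:t} ‖ a_{1:t})`: the probability that the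
output of `U` on the actions `a_{1:t}` starts with `e_{1:t}`, when its input tape is filled with
uniformly random bits. It equals the sum of `2^(-|p|)` over the minimal programs `p` with
`e_{1:t} ⊑ U(p, a_{1:t})`. -/
def MonotoneMachine.mixture (U : MonotoneMachine A E) (h : History A E) : ℝ :=
  coinFlips.real {ω | ∃ k : ℕ,
    U.Outputs (List.ofFn fun i : Fin k => ω i) (h.map Prod.fst) (h.map Prod.snd)}

end Machines

section Values

variable {A E : Type*}

/-- `Γ_t = ∑_{i ≥ t} γ_i`. -/
def discountNorm (γ : ℕ → ℝ) (t : ℕ) : ℝ := ∑' i, γ (t + i)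

/-- The discount function for lifetime `m`: `1` up to time `m` and `0` afterwards. -/
def lifetimeDiscount (m t : ℕ) : ℝ := if t ≤ m then 1 else 0

/-- The history that extends `h` if the next percepts are `e_1, e_2, …` and the actions are those
of the policy `π`. -/
def extend (π : Policy A E) : History A E → List E → History A E
  | h, [] => h
  | h, e :: es => extend π (h ++ [(π h, e)]) es

/-- For `h = æ_{<t}`, where `t = |h| + 1`, and for `m = |h| + n`, the sum
`∑_{e_{t:m}} R(e_{t:m}) ν(e_{1:m} | e_{<t} ‖ a_{1:m})` with the actions chosen by `π` from time
`t` on and `R(e_{t:m}) = ∑_{k=t}^m γ_k r_k`. -/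
def partialValue [Fintype E] (γ : ℕ → ℝ) (r : E → ℝ) (ν : History A E → ℝ) (π : Policy A E)
    (h : History A E) (n : ℕ) : ℝ :=
  ∑ es : Fin n → E, (∑ j : Fin n, γ (h.length + 1 + j) * r (es j)) *
    (ν (extend π h (List.ofFn es)) / ν h)

/-- The iterative value `V^π_ν(h)`. -/
def value [Fintype E] (γ : ℕ → ℝ) (r : E → ℝ) (ν : History A E → ℝ) (π : Policy A E)
    (h : History A E) : ℝ :=
  open Classical in
  if 0 < discountNorm γ (h.length + 1) then
    1 / discountNorm γ (h.length + 1) * limUnder atTop (partialValue γ r ν π h)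
  else 0

/-- The value for lifetime `m` when the sum over the percepts stops at time `m`, in place of
passing to the limit of later and later times. -/
def valueUpTo [Fintype E] (m : ℕ) (r : E → ℝ) (ν : History A E → ℝ) (π : Policy A E)
    (h : History A E) : ℝ :=
  open Classical in
  if 0 < discountNorm (lifetimeDiscount m) (h.length + 1) then
    1 / discountNorm (lifetimeDiscount m) (h.length + 1) *
      partialValue (lifetimeDiscount m) r ν π h (m - h.length)
  else 0

/-- `π` is optimal for the value function `V`: at every history it attains the optimal value
`V^*(h) = sup_π V^π(h)`. -/
def IsOptimal (V : Policy A E → History A E → ℝ) (π : Policy A E) : Prop :=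
  ∀ h, V π h = ⨆ π' : Policy A E, V π' h

/-- The function `π`, which takes a lifetime and returns a policy, is a version of
finite-lifetime AIXI for the universal mixture `ξ`. -/
def IsAIXILT [Fintype E] (r : E → ℝ) (ξ : History A E → ℝ) (π : ℕ → Policy A E) : Prop :=
  ∀ m, IsOptimal (value (lifetimeDiscount m) r ξ) (π m)

/-- Finite-lifetime AIXI for the value that stops at the lifetime. -/
def IsAIXILTUpTo [Fintype E] (r : E → ℝ) (ξ : History A E → ℝ) (π : ℕ → Policy A E) : Prop :=
  ∀ m, IsOptimal (valueUpTo m r ξ) (π m)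

/-- The policy `π` is a version of discounted AIXI for the universal mixture `ξ`. -/
def IsAIXIDC [Fintype E] (γ : ℕ → ℝ) (r : E → ℝ) (ξ : History A E → ℝ) (π : Policy A E) : Prop :=
  IsOptimal (value γ r ξ) π

/-- `γ` is an infinite-horizon discount function: nonnegative, summable, lower semicomputable,
and with `Γ_t > 0` for all `t`. -/
structure IsDiscount (γ : ℕ → ℝ) : Prop where
  nonneg : ∀ t, 0 ≤ γ t
  summable : Summable γ
  lowerSemicomputable : LowerSemicomputable γ
  norm_pos : ∀ t, 0 < discountNorm γ t

end Values

end AIXI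

end

noncomputable section

namespace AIXI

/-! ### Upper and lower bounds on values in terms of single branches. -/

section ValueBounds

variable {A E : Type*}

/-! The proof is a diagonal argument. Against a computable policy `π` play the environment that
answers `e₀` (reward `0`) while the actions agree with `π` and `e₁` (positive reward) from the first
deviation on. It is computable, so `ξ` is at least some constant `c > 0` on all its histories
(`exists_pos_le_of_universal`).

Along the branch where `π` acts and only `e₀` arrives, `ξ` decreases and stays above `c`, hence
converges. Far enough along, at a history `h`, the mass still to be lost is at most some `δ < r e₁ *
c` (`exists_history_of_computable`). Only this lost mass can earn reward for `π`, so its value is at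
most `δ / ξ h` (`partialValue_le`). Deviating at `h` and then repeating the same action keeps the
branch of `e₁` above `c`, so it earns at least `r e₁ * c / ξ h` (`le_value`). Thus `π` is not
optimal at `h`.

For finite lifetimes the diagonal policy that always acts as in the last step of a lifetime is used,
and only one step is compared. -/

theorem extend_append (π : Policy A E) (h : History A E) (es es' : List E) :
    extend π h (es ++ es') = extend π (extend π h es) es' := by
  induction es generalizing h with
  | nil => rfl
  | cons e es ih => exact ih _

theorem extend_concat (π : Policy A E) (h : History A E) (es : List E) (e : E) :
    extend π h (es ++ [e]) = extend π h es ++ [(π (extend π h es), e)] := by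
  rw [extend_append]; rfl

theorem ofFn_snoc {n : ℕ} (es : Fin n → E) (e : E) :
    List.ofFn (Fin.snoc es e : Fin (n + 1) → E) = List.ofFn es ++ [e] := by
  rw [List.ofFn_succ']; simp

theorem sum_snoc [Fintype E] {n : ℕ} (f : (Fin (n + 1) → E) → ℝ) :
    ∑ es, f es = ∑ es : Fin n → E, ∑ e, f (Fin.snoc es e) := by
  rw [← (Fin.snocEquiv fun _ : Fin (n + 1) => E).sum_comp, Fintype.sum_prod_type_right]
  rfl

variable [Fintype E] {γ : ℕ → ℝ} {r : E → ℝ} {ν : History A E → ℝ} {π : Policy A E}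
  {h : History A E}

/-- The weight does not see the last percept, so that percept can be summed out by the semimeasure
inequality. -/
theorem sum_weighted_extend_succ_le (hν : IsChronologicalSemimeasure ν) {n : ℕ}
    (g : (Fin n → E) → ℝ) (hg : ∀ es, 0 ≤ g es) :
    ∑ es : Fin n → E, ∑ e, g es * ν (extend π h (List.ofFn (Fin.snoc es e : Fin (n + 1) → E))) ≤
      ∑ es : Fin n → E, g es * ν (extend π h (List.ofFn es)) := by
  refine Finset.sum_le_sum fun es _ => ?_
  rw [← Finset.mul_sum]
  refine mul_le_mul_of_nonneg_left ?_ (hg es)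
  simp only [ofFn_snoc, extend_concat]
  exact hν.sum_le _ _

theorem sum_extend_le (hν : IsChronologicalSemimeasure ν) (n : ℕ) :
    ∑ es : Fin n → E, ν (extend π h (List.ofFn es)) ≤ ν h := by
  induction n with
  | zero => simp [extend]
  | succ n ih =>
    rw [sum_snoc]
    refine le_trans ?_ ih
    simpa using sum_weighted_extend_succ_le (π := π) (h := h) hν (n := n) (fun _ => 1)
      (fun _ => zero_le_one)

theorem antitone_extend_replicate (hν : IsChronologicalSemimeasure ν) (e₀ : E) :
    Antitone fun n => ν (extend π h (List.replicate n e₀)) := by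
  refine antitone_nat_of_succ_le fun n => ?_
  rw [List.replicate_succ', extend_concat]
  exact (Finset.single_le_sum (f := fun e => ν (extend π h (List.replicate n e₀) ++ [(_, e)]))
    (fun e _ => hν.nonneg _) (Finset.mem_univ e₀)).trans (hν.sum_le _ _)

theorem partialValue_nonneg (hν : IsChronologicalSemimeasure ν) (hγ : ∀ t, 0 ≤ γ t)
    (hr : ∀ e, r e ∈ Set.Icc (0 : ℝ) 1) (n : ℕ) : 0 ≤ partialValue γ r ν π h n :=
  Finset.sum_nonneg fun _ _ => mul_nonneg
    (Finset.sum_nonneg fun _ _ => mul_nonneg (hγ _) (hr _).1)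
    (div_nonneg (hν.nonneg _) (hν.nonneg _))

omit [Fintype E] in
theorem sum_reward_le (hγ : ∀ t, 0 ≤ γ t) (hγs : Summable γ)
    (hr : ∀ e, r e ∈ Set.Icc (0 : ℝ) 1) (t : ℕ) {n : ℕ} (es : Fin n → E) :
    ∑ j : Fin n, γ (t + j) * r (es j) ≤ discountNorm γ t :=
  calc ∑ j : Fin n, γ (t + j) * r (es j) ≤ ∑ j : Fin n, γ (t + j) :=
        Finset.sum_le_sum fun _ _ => mul_le_of_le_one_right (hγ _) (hr _).2
    _ = ∑ j ∈ Finset.range n, γ (t + j) := Fin.sum_univ_eq_sum_range (fun j => γ (t + j)) n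
    _ ≤ discountNorm γ t := Summable.sum_le_tsum _ (fun _ _ => hγ _)
        (hγs.comp_injective (add_right_injective t))

theorem discountNorm_nonneg (hγ : ∀ t, 0 ≤ γ t) (t : ℕ) : 0 ≤ discountNorm γ t :=
  tsum_nonneg fun _ => hγ _

/-- If `e₀` has reward `0`, then all the value comes from the probability of leaving the branch
on which every percept is `e₀`. -/
theorem partialValue_le (hν : IsChronologicalSemimeasure ν) (hγ : ∀ t, 0 ≤ γ t)
    (hγs : Summable γ) (hr : ∀ e, r e ∈ Set.Icc (0 : ℝ) 1) {e₀ : E} (he₀ : r e₀ = 0) (n : ℕ) :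
    partialValue γ r ν π h n ≤ discountNorm γ (h.length + 1) *
      ((ν h - ν (extend π h (List.replicate n e₀))) / ν h) := by
  classical
  set Γ := discountNorm γ (h.length + 1)
  have hΓ : 0 ≤ Γ := discountNorm_nonneg hγ _
  -- The all-`e₀` string earns nothing, so its mass may be removed; every other string earns at most
  -- `Γ`.
  have key : ∀ es : Fin n → E,
      (∑ j : Fin n, γ (h.length + 1 + j) * r (es j)) * (ν (extend π h (List.ofFn es)) / ν h) ≤
        Γ / ν h * (ν (extend π h (List.ofFn es)) -
          if es = fun _ => e₀ then ν (extend π h (List.replicate n e₀)) else 0) := by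
    intro es
    split_ifs with hes
    · subst hes
      simp [he₀, List.ofFn_const]
    · rw [sub_zero, div_mul_eq_mul_div, mul_div_assoc]
      exact mul_le_mul_of_nonneg_right (sum_reward_le hγ hγs hr _ es)
        (div_nonneg (hν.nonneg _) (hν.nonneg _))
  refine (Finset.sum_le_sum fun es _ => key es).trans ?_
  rw [← Finset.mul_sum, Finset.sum_sub_distrib, Finset.sum_ite_eq' Finset.univ,
    if_pos (Finset.mem_univ _), div_mul_eq_mul_div, mul_div_assoc]
  refine mul_le_mul_of_nonneg_left (div_le_div_of_nonneg_right ?_ (hν.nonneg _)) hΓ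
  exact sub_le_sub_right (sum_extend_le hν n) _

theorem partialValue_le_discountNorm (hν : IsChronologicalSemimeasure ν) (hγ : ∀ t, 0 ≤ γ t)
    (hγs : Summable γ) (hr : ∀ e, r e ∈ Set.Icc (0 : ℝ) 1) {e₀ : E} (he₀ : r e₀ = 0) (n : ℕ) :
    partialValue γ r ν π h n ≤ discountNorm γ (h.length + 1) := by
  refine (partialValue_le hν hγ hγs hr he₀ n).trans
    (mul_le_of_le_one_right (discountNorm_nonneg hγ _) (div_le_one_of_le₀ ?_ (hν.nonneg _)))
  exact sub_le_self _ (hν.nonneg _)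

/-- All summands are nonnegative, so the one of the constant string `e₁` is a lower bound. -/
theorem le_partialValue (hν : IsChronologicalSemimeasure ν) (hγ : ∀ t, 0 ≤ γ t)
    (hr : ∀ e, r e ∈ Set.Icc (0 : ℝ) 1) (e₁ : E) (n : ℕ) :
    (∑ j ∈ Finset.range n, γ (h.length + 1 + j)) *
      (r e₁ * (ν (extend π h (List.replicate n e₁)) / ν h)) ≤ partialValue γ r ν π h n := by
  refine le_trans (le_of_eq ?_) (Finset.single_le_sum (fun es _ => mul_nonneg
    (Finset.sum_nonneg fun j _ => mul_nonneg (hγ _) (hr _).1)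
    (div_nonneg (hν.nonneg _) (hν.nonneg _))) (Finset.mem_univ fun _ => e₁))
  rw [List.ofFn_const, ← Finset.sum_mul, mul_assoc,
    Fin.sum_univ_eq_sum_range (fun j => γ (h.length + 1 + j)) n]

/-- The new reward is at most its discount factor; after that replacement the last percept can be
summed out, which only loses mass. -/
theorem partialValue_succ_le (hν : IsChronologicalSemimeasure ν) (hγ : ∀ t, 0 ≤ γ t)
    (hr : ∀ e, r e ∈ Set.Icc (0 : ℝ) 1) (n : ℕ) :
    partialValue γ r ν π h (n + 1) ≤ partialValue γ r ν π h n + γ (h.length + 1 + n) := by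
  set g : (Fin n → E) → ℝ := fun es => ∑ j : Fin n, γ (h.length + 1 + j) * r (es j) with hg
  set c := γ (h.length + 1 + n) with hc
  have hc0 : 0 ≤ c := hγ _
  have hg0 : ∀ es, 0 ≤ g es := fun es =>
    Finset.sum_nonneg fun j _ => mul_nonneg (hγ _) (hr _).1
  have h1 : partialValue γ r ν π h (n + 1) ≤ (∑ es : Fin n → E, ∑ e, (g es + c) *
      ν (extend π h (List.ofFn (Fin.snoc es e : Fin (n + 1) → E)))) / ν h := by
    rw [partialValue, sum_snoc, Finset.sum_div]
    refine Finset.sum_le_sum fun es _ => ?_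
    rw [Finset.sum_div]
    refine Finset.sum_le_sum fun e _ => ?_
    rw [mul_div_assoc]
    refine mul_le_mul_of_nonneg_right ?_ (div_nonneg (hν.nonneg _) (hν.nonneg _))
    rw [Fin.sum_univ_castSucc]
    simp only [Fin.snoc_castSucc, Fin.snoc_last, Fin.val_castSucc, Fin.val_last]
    exact add_le_add le_rfl (mul_le_of_le_one_right hc0 (hr _).2)
  refine h1.trans ((div_le_div_of_nonneg_right (sum_weighted_extend_succ_le hν (fun es => g es + c)
    fun es => add_nonneg (hg0 es) hc0) (hν.nonneg _)).trans ?_)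
  simp only [add_mul]
  rw [Finset.sum_add_distrib, ← Finset.mul_sum, add_div, Finset.sum_div]
  refine add_le_add (le_of_eq (Finset.sum_congr rfl fun es _ => mul_div_assoc _ _ _)) ?_
  rw [mul_div_assoc]
  exact mul_le_of_le_one_right hc0 (div_le_one_of_le₀ (sum_extend_le hν n) (hν.nonneg _))

theorem tendsto_sum_discount (hγs : Summable γ) (t : ℕ) :
    Tendsto (fun n => ∑ j ∈ Finset.range n, γ (t + j)) atTop (nhds (discountNorm γ t)) :=
  (hγs.comp_injective (add_right_injective t)).hasSum.tendsto_sum_nat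

/-- The limit in the definition of the value exists. -/
theorem tendsto_partialValue (hν : IsChronologicalSemimeasure ν) (hγ : ∀ t, 0 ≤ γ t)
    (hγs : Summable γ) (hr : ∀ e, r e ∈ Set.Icc (0 : ℝ) 1) :
    Tendsto (partialValue γ r ν π h) atTop (nhds (limUnder atTop (partialValue γ r ν π h))) := by
  refine tendsto_nhds_limUnder ?_
  set s : ℕ → ℝ := fun n => ∑ j ∈ Finset.range n, γ (h.length + 1 + j) with hs
  -- A semimeasure may lose mass, so the partial values need not be monotone; subtracting the
  -- partial sums of the discount makes them so.
  have hanti : Antitone fun n => partialValue γ r ν π h n - s n := by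
    refine antitone_nat_of_succ_le fun n => ?_
    have := partialValue_succ_le (π := π) (h := h) hν hγ hr n
    simp only [hs, Finset.sum_range_succ]
    linarith
  have hbdd : BddBelow (Set.range fun n => partialValue γ r ν π h n - s n) := by
    refine ⟨-discountNorm γ (h.length + 1), ?_⟩
    rintro _ ⟨n, rfl⟩
    have h1 := partialValue_nonneg (π := π) (h := h) hν hγ hr n
    have h2 : s n ≤ discountNorm γ (h.length + 1) := Summable.sum_le_tsum _ (fun _ _ => hγ _)
        (hγs.comp_injective (add_right_injective _))
    simp only
    linarith
  refine ⟨_, ((tendsto_atTop_ciInf hanti hbdd).add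
    (tendsto_sum_discount hγs (h.length + 1))).congr fun n => ?_⟩
  simp only [hs]
  ring

theorem value_le_of_eventually (hν : IsChronologicalSemimeasure ν) (hγ : ∀ t, 0 ≤ γ t)
    (hγs : Summable γ) (hr : ∀ e, r e ∈ Set.Icc (0 : ℝ) 1) {b : ℝ} (hb : 0 ≤ b)
    (hle : ∀ᶠ n in atTop, partialValue γ r ν π h n ≤ discountNorm γ (h.length + 1) * b) :
    value γ r ν π h ≤ b := by
  rw [value]
  split_ifs with hΓ
  · rw [one_div, inv_mul_le_iff₀ hΓ]
    exact le_of_tendsto (tendsto_partialValue hν hγ hγs hr) hle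
  · exact hb

theorem value_le_one (hν : IsChronologicalSemimeasure ν) (hγ : ∀ t, 0 ≤ γ t)
    (hγs : Summable γ) (hr : ∀ e, r e ∈ Set.Icc (0 : ℝ) 1) {e₀ : E} (he₀ : r e₀ = 0) :
    value γ r ν π h ≤ 1 :=
  value_le_of_eventually hν hγ hγs hr zero_le_one <| Eventually.of_forall fun n =>
    (partialValue_le_discountNorm hν hγ hγs hr he₀ n).trans_eq (mul_one _).symm

theorem le_value (hν : IsChronologicalSemimeasure ν) (hγ : ∀ t, 0 ≤ γ t)
    (hγs : Summable γ) (hr : ∀ e, r e ∈ Set.Icc (0 : ℝ) 1)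
    (hΓ : 0 < discountNorm γ (h.length + 1)) {e₁ : E} {c : ℝ}
    (hc : ∀ n, c ≤ ν (extend π h (List.replicate n e₁))) :
    r e₁ * (c / ν h) ≤ value γ r ν π h := by
  rw [value, if_pos hΓ, one_div, le_inv_mul_iff₀ hΓ]
  refine le_of_tendsto_of_tendsto' ((tendsto_sum_discount hγs (h.length + 1)).mul_const _)
    (tendsto_partialValue hν hγ hγs hr) fun n => le_trans ?_ (le_partialValue hν hγ hr e₁ n)
  exact mul_le_mul_of_nonneg_left (mul_le_mul_of_nonneg_left
    (div_le_div_of_nonneg_right (hc n) (hν.nonneg _)) (hr _).1)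
    (Finset.sum_nonneg fun _ _ => hγ _)

theorem lifetimeDiscount_nonneg (m t : ℕ) : 0 ≤ lifetimeDiscount m t := by
  unfold lifetimeDiscount; split_ifs <;> simp

theorem summable_lifetimeDiscount (m : ℕ) : Summable (lifetimeDiscount m) :=
  summable_of_ne_finset_zero (s := Finset.range (m + 1)) fun t ht =>
    if_neg fun h => ht (Finset.mem_range.2 (by omega))

theorem discountNorm_lifetimeDiscount_self (m : ℕ) :
    discountNorm (lifetimeDiscount m) m = 1 := by
  rw [discountNorm, tsum_eq_single 0]
  · simp [lifetimeDiscount]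
  · intro i hi
    exact if_neg (by omega)

/-- In the last step of a lifetime the value is at most the one-step value. -/
theorem value_last_step_le (hν : IsChronologicalSemimeasure ν)
    (hr : ∀ e, r e ∈ Set.Icc (0 : ℝ) 1) {e₀ : E} (he₀ : r e₀ = 0) :
    value (lifetimeDiscount (h.length + 1)) r ν π h ≤
      (ν h - ν (extend π h (List.replicate 1 e₀))) / ν h := by
  have hγ := lifetimeDiscount_nonneg (h.length + 1)
  have hγs := summable_lifetimeDiscount (h.length + 1)
  refine value_le_of_eventually hν hγ hγs hr (div_nonneg (sub_nonneg.2
    (antitone_extend_replicate (π := π) (h := h) hν e₀ zero_le_one)) (hν.nonneg _))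
    (eventually_atTop.2 ⟨1, fun n hn => ?_⟩)
  induction n, hn using Nat.le_induction with
  | base => exact partialValue_le hν hγ hγs hr he₀ 1
  | succ n hn ih =>
    refine (partialValue_succ_le hν hγ hr n).trans ?_
    -- Past the lifetime no reward counts, so lengthening the horizon cannot raise the partial
    -- value.
    have : lifetimeDiscount (h.length + 1) (h.length + 1 + n) = 0 := if_neg (by omega)
    rwa [this, add_zero]

theorem valueUpTo_last_step :
    valueUpTo (h.length + 1) r ν π h =
      partialValue (lifetimeDiscount (h.length + 1)) r ν π h 1 := by
  simp [valueUpTo, discountNorm_lifetimeDiscount_self]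

omit [Fintype E] in
/-- An optimal policy has at every history at least the value of every other policy. -/
theorem IsOptimal.le {V : Policy A E → History A E → ℝ} {π π' : Policy A E} {b : ℝ}
    (hπ : IsOptimal V π) (h : History A E) (hb : ∀ π', V π' h ≤ b) : V π' h ≤ V π h := by
  rw [hπ h]
  -- The bound `b` is essential: a real supremum over an unbounded family is `0` by default.
  exact le_ciSup (f := fun π' => V π' h) ⟨b, by rintro _ ⟨π', rfl⟩; exact hb π'⟩ π'

end ValueBounds

/-! ### The adversarial environment: correctness and computability. -/

section Adversary

/-- Primitive recursion on the number of processed entries computes the fold; the `none` case of the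
lookup never occurs within the length of the list. -/
theorem _root_.Computable.list_foldl {α β σ : Type*} [Primcodable α] [Primcodable β]
    [Primcodable σ] {f : α → List β} {g : α → σ} {s : σ → β → σ}
    (hf : Computable f) (hg : Computable g) (hs : Computable₂ s) :
    Computable fun a => (f a).foldl s (g a) := by
  have step : Computable₂ fun (a : α) (q : ℕ × σ) =>
      Option.casesOn (motive := fun _ => σ) ((f a)[q.1]?) q.2 (s q.2) :=
    Computable.option_casesOn
      (Computable.list_getElem?.comp (hf.comp Computable.fst)
        (Computable.fst.comp Computable.snd))
      (Computable.snd.comp Computable.snd)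
      (hs.comp (Computable.snd.comp (Computable.snd.comp Computable.fst)) Computable.snd)
  refine (Computable.nat_rec (Computable.list_length.comp hf) hg step).of_eq fun a => ?_
  have key : ∀ n, n ≤ (f a).length → Nat.rec (motive := fun _ => σ) (g a)
      (fun y IH => Option.casesOn (motive := fun _ => σ) ((f a)[y]?) IH (s IH)) n =
        ((f a).take n).foldl s (g a) := by
    intro n hn
    induction n with
    | zero => rfl
    | succ n ih =>
      simp only [ih (by omega), List.getElem?_eq_getElem (show n < (f a).length by omega)]
      rw [List.take_add_one, List.foldl_append,
        List.getElem?_eq_getElem (show n < (f a).length by omega)]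
      rfl
  simpa using key _ le_rfl

variable {A E : Type*} [DecidableEq A] (π : Policy A E) (e₀ e₁ : E)

/-- One step of the adversarial environment: the state consists of the history so far and a flag
that tells whether an action has deviated from `π`; the percept is `e₀` before and `e₁` from the
first deviation on. -/
def adversaryStep (s : History A E × Bool) (a : A) : History A E × Bool :=
  (s.1 ++ [(a, bif s.2 || decide (a ≠ π s.1) then e₁ else e₀)], s.2 || decide (a ≠ π s.1))

/-- The state of the adversarial environment after the given actions. -/
def adversaryState (as : List A) : History A E × Bool :=
  as.foldl (adversaryStep π e₀ e₁) ([], false)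

/-- The history that the adversarial environment produces on the given actions. -/
def adversaryHistory (as : List A) : History A E := (adversaryState π e₀ e₁ as).1

theorem adversaryState_concat (as : List A) (a : A) :
    adversaryState π e₀ e₁ (as ++ [a]) = adversaryStep π e₀ e₁ (adversaryState π e₀ e₁ as) a := by
  simp [adversaryState]

theorem map_fst_adversaryHistory (as : List A) :
    (adversaryHistory π e₀ e₁ as).map Prod.fst = as := by
  induction as using List.reverseRecOn with
  | nil => rfl
  | append_singleton as a ih =>
    rw [adversaryHistory] at ih ⊢
    rw [adversaryState_concat, adversaryStep]
    simp [ih]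

theorem length_adversaryHistory (as : List A) :
    (adversaryHistory π e₀ e₁ as).length = as.length := by
  simpa using congrArg List.length (map_fst_adversaryHistory π e₀ e₁ as)

theorem adversaryHistory_prefix_append (as as' : List A) :
    adversaryHistory π e₀ e₁ as <+: adversaryHistory π e₀ e₁ (as ++ as') := by
  induction as' using List.reverseRecOn with
  | nil => simp
  | append_singleton as' a ih =>
    refine ih.trans ?_
    rw [← List.append_assoc, adversaryHistory, adversaryHistory, adversaryState_concat]
    exact List.prefix_append _ _

theorem adversaryHistory_take (as : List A) (k : ℕ) :
    adversaryHistory π e₀ e₁ (as.take k) = (adversaryHistory π e₀ e₁ as).take k := by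
  have h := adversaryHistory_prefix_append π e₀ e₁ (as.take k) (as.drop k)
  rw [List.take_append_drop, List.prefix_iff_eq_take, length_adversaryHistory,
    List.length_take, ← length_adversaryHistory π e₀ e₁ as] at h
  rw [h]
  simp [List.take_eq_take_iff]

variable {π e₀ e₁}

theorem adversaryState_following (n : ℕ) :
    adversaryState π e₀ e₁ ((extend π [] (List.replicate n e₀)).map Prod.fst) =
      (extend π [] (List.replicate n e₀), false) := by
  induction n with
  | zero => rfl
  | succ n ih =>
    rw [List.replicate_succ', extend_concat, List.map_append, List.map_singleton,
      adversaryState_concat, ih]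
    simp [adversaryStep]

/-- Once raised, the flag stays raised, so only the first action has to differ from `π`. The
exponent is `n + 1` because the flag is still down at `h` itself. -/
theorem adversaryState_deviating {h : History A E} {b : A}
    (hh : adversaryState π e₀ e₁ (h.map Prod.fst) = (h, false)) (hb : b ≠ π h) (n : ℕ) :
    adversaryState π e₀ e₁
        ((extend (fun _ => b) h (List.replicate (n + 1) e₁)).map Prod.fst) =
      (extend (fun _ => b) h (List.replicate (n + 1) e₁), true) := by
  induction n with
  | zero => simp [extend, adversaryState_concat, hh, adversaryStep, hb]
  | succ n ih =>
    rw [List.replicate_succ', extend_concat, List.map_append, List.map_singleton,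
      adversaryState_concat, ih]
    simp [adversaryStep]

theorem adversaryHistory_deviating {h : History A E} {b : A}
    (hh : adversaryState π e₀ e₁ (h.map Prod.fst) = (h, false)) (hb : b ≠ π h) (n : ℕ) :
    adversaryHistory π e₀ e₁
        ((extend (fun _ => b) h (List.replicate n e₁)).map Prod.fst) =
      extend (fun _ => b) h (List.replicate n e₁) := by
  cases n with
  | zero => exact congrArg Prod.fst hh
  | succ n => exact congrArg Prod.fst (adversaryState_deviating hh hb n)

theorem computable_adversaryHistory [Primcodable A] [Primcodable E] (hπ : Computable π)
    (e₀ e₁ : E) : Computable (adversaryHistory π e₀ e₁) := by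
  have hdev : Computable fun x : (History A E × Bool) × A =>
      (x.1.2 || decide (x.2 ≠ π x.1.1)) := by
    have hne : Computable₂ fun a b : A => decide (a ≠ b) :=
      (PrimrecPred.decide (Primrec.eq (α := A)).not).to_comp
    exact Primrec.or.to_comp.comp (Computable.snd.comp Computable.fst)
      (hne.comp Computable.snd (hπ.comp (Computable.fst.comp Computable.fst)))
  have hstep : Computable₂ (adversaryStep π e₀ e₁) :=
    Computable.pair (Computable.list_concat.comp (Computable.fst.comp Computable.fst)
      (Computable.pair Computable.snd
        (Computable.cond hdev (Computable.const e₁) (Computable.const e₀)))) hdev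
  exact Computable.fst.comp (Computable.list_foldl Computable.id (Computable.const _) hstep)

variable (π e₀ e₁) in
/-- The adversarial environment as a deterministic chronological semimeasure. -/
def adversaryMeasure [DecidableEq E] (h : History A E) : ℝ :=
  if adversaryHistory π e₀ e₁ (h.map Prod.fst) = h then 1 else 0

theorem isChronologicalSemimeasure_adversaryMeasure [DecidableEq E] [Fintype E] :
    IsChronologicalSemimeasure (adversaryMeasure π e₀ e₁) where
  nonneg h := by unfold adversaryMeasure; split_ifs <;> simp
  nil_le_one := by unfold adversaryMeasure; split_ifs <;> simp
  sum_le h a := by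
    -- Determinism: after the action `a` all the mass of `h` passes to the single percept `e'`.
    set e' := bif (adversaryState π e₀ e₁ (h.map Prod.fst)).2 ||
      decide (a ≠ π (adversaryState π e₀ e₁ (h.map Prod.fst)).1) then e₁ else e₀ with he'
    have key : ∀ e, adversaryMeasure π e₀ e₁ (h ++ [(a, e)]) =
        if e' = e then adversaryMeasure π e₀ e₁ h else 0 := by
      intro e
      have : adversaryHistory π e₀ e₁ ((h ++ [(a, e)]).map Prod.fst) =
          adversaryHistory π e₀ e₁ (h.map Prod.fst) ++ [(a, e')] := by
        rw [List.map_append, adversaryHistory, List.map_singleton, adversaryState_concat]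
        rfl
      simp only [adversaryMeasure, this, List.append_singleton_inj, Prod.mk.injEq, true_and]
      split_ifs <;> simp_all
    simp [key]

theorem lowerSemicomputable_indicator {α : Type*} [Primcodable α] {p : α → Bool}
    (hp : Computable p) : LowerSemicomputable fun x => if p x = true then (1 : ℝ) else 0 := by
  -- Clearing the denominator turns `(a - b) / (c + 1) < 1` into `a < b + (c + 1)`, and the
  -- comparison with `0` into `a < b`; both are decidable in `ℕ`.
  refine REPred.of_eq (p := fun x : α × (ℕ × ℕ × ℕ) =>
    x.2.1 < x.2.2.1 + bif p x.1 then x.2.2.2 + 1 else 0) (ComputablePred.to_re ?_) ?_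
  · refine ⟨inferInstance, ?_⟩
    have hlt : Computable₂ fun a b : ℕ => decide (a < b) :=
      (PrimrecRel.decide Primrec.nat_lt).to_comp
    have hq : Computable fun x : α × (ℕ × ℕ × ℕ) => x.2.2 := Computable.snd.comp Computable.snd
    exact hlt.comp (Computable.fst.comp Computable.snd)
      (Primrec.nat_add.to_comp.comp (Computable.fst.comp hq)
        (Computable.cond (hp.comp Computable.fst)
          (Computable.succ.comp (Computable.snd.comp hq)) (Computable.const 0)))
  · rintro ⟨x, a, b, c⟩
    have hc : (0 : ℝ) < c + 1 := by positivity
    simp only [ratOfCode]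
    push_cast
    rw [div_lt_iff₀ hc]
    cases p x
    · simp
    · simp only [cond_true, if_true, one_mul, sub_lt_iff_lt_add']
      norm_cast

theorem adversaryMeasure_mem_environmentClass [Primcodable A] [Fintype E] [Primcodable E]
    [DecidableEq E] (hπ : Computable π) : adversaryMeasure π e₀ e₁ ∈ environmentClass A E := by
  refine ⟨isChronologicalSemimeasure_adversaryMeasure, ?_⟩
  classical
  have hp : Computable fun h : History A E =>
      decide (adversaryHistory π e₀ e₁ (h.map Prod.fst) = h) := by
    have heq : Computable₂ fun h h' : History A E => decide (h = h') :=
      (PrimrecRel.decide Primrec.eq).to_comp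
    exact heq.comp ((computable_adversaryHistory hπ e₀ e₁).comp
      (Primrec.list_map Primrec.id (Primrec.fst.comp Primrec.snd).to₂).to_comp) Computable.id
  have := lowerSemicomputable_indicator hp
  simp only [decide_eq_true_eq] at this
  convert! this

variable (π e₀ e₁) in
/-- The adversarial environment as a chronological monotone machine that ignores its program. -/
def adversaryMachine [Primcodable A] [Primcodable E] (hπ : Computable π) :
    MonotoneMachine A E where
  run _ as _ := (adversaryHistory π e₀ e₁ as).map Prod.snd
  computable_run := (Primrec.list_map Primrec.id (Primrec.snd.comp Primrec.snd).to₂).to_comp.comp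
    ((computable_adversaryHistory hπ e₀ e₁).comp (Computable.fst.comp Computable.snd))
  monotone _ _ _ _ _ := List.prefix_rfl
  chronological _ as _ k := by rw [adversaryHistory_take, List.map_take]

end Adversary

/-! ### Universal mixtures: semimeasure property and domination. -/

section Mixtures

variable {A E : Type*} [Primcodable A] [Primcodable E] [Fintype E]

omit [Primcodable A] [Primcodable E] in
theorem IsChronologicalSemimeasure.le_one {ν : History A E → ℝ}
    (hν : IsChronologicalSemimeasure ν) (h : History A E) : ν h ≤ 1 := by
  induction h using List.reverseRecOn with
  | nil => exact hν.nil_le_one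
  | append_singleton h x ih =>
    exact (Finset.single_le_sum (f := fun e => ν (h ++ [(x.1, e)])) (fun e _ => hν.nonneg _)
      (Finset.mem_univ x.2)).trans ((hν.sum_le h x.1).trans ih)

theorem IsUniversalPrior.summable_mul {w : environmentClass A E → ℝ} (hw : IsUniversalPrior w)
    (h : History A E) : Summable fun ν : environmentClass A E => w ν * (ν : History A E → ℝ) h :=
  hw.summable.of_nonneg_of_le (fun ν => mul_nonneg (hw.pos ν).le (ν.2.1.nonneg h))
    fun ν => mul_le_of_le_one_right (hw.pos ν).le (ν.2.1.le_one h)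

theorem isChronologicalSemimeasure_mixture {w : environmentClass A E → ℝ}
    (hw : IsUniversalPrior w) : IsChronologicalSemimeasure (mixture w) where
  nonneg h := tsum_nonneg fun ν => mul_nonneg (hw.pos ν).le (ν.2.1.nonneg h)
  nil_le_one := (Summable.tsum_le_tsum
    (fun ν => mul_le_of_le_one_right (hw.pos ν).le ν.2.1.nil_le_one)
    (hw.summable_mul []) hw.summable).trans hw.tsum_le_one
  sum_le h a := by
    unfold mixture
    rw [← Summable.tsum_finsetSum fun e _ => hw.summable_mul _]
    refine Summable.tsum_le_tsum (fun ν => ?_) (summable_sum fun e _ => hw.summable_mul _)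
      (hw.summable_mul h)
    rw [← Finset.mul_sum]
    exact mul_le_mul_of_nonneg_left (ν.2.1.sum_le h a) (hw.pos ν).le

theorem le_mixture {w : environmentClass A E → ℝ} (hw : IsUniversalPrior w)
    (ν : environmentClass A E) (h : History A E) :
    w ν * (ν : History A E → ℝ) h ≤ mixture w h :=
  (hw.summable_mul h).le_tsum ν fun ν' _ => mul_nonneg (hw.pos ν').le (ν'.2.1.nonneg h)

instance : IsProbabilityMeasure coinFlips := by unfold coinFlips; infer_instance

omit [Fintype E] in
theorem measurableSet_outputs (U : MonotoneMachine A E) (a : List A) (e : List E) :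
    MeasurableSet {ω : ℕ → Bool | ∃ k : ℕ, U.Outputs (List.ofFn fun i : Fin k => ω i) a e} := by
  rw [Set.ofPred_exists]
  refine MeasurableSet.iUnion fun k => ?_
  have hm : Measurable fun (ω : ℕ → Bool) (i : Fin k) => ω i := by fun_prop
  exact hm (t := {p : Fin k → Bool | U.Outputs (List.ofFn p) a e})
    (Set.toFinite _).measurableSet

theorem ofFn_prefix_ofFn {α : Type*} (ω : ℕ → α) {k l : ℕ} (hkl : k ≤ l) :
    (List.ofFn fun i : Fin k => ω i) <+: List.ofFn fun i : Fin l => ω i := by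
  rw [List.prefix_iff_eq_take]
  refine List.ext_getElem (by simp [hkl]) fun i h1 h2 => by simp

omit [Fintype E] in
theorem MonotoneMachine.Outputs.mono {U : MonotoneMachine A E} {p p' : List Bool} {a : List A}
    {e : List E} (hpp : p <+: p') (ho : U.Outputs p a e) : U.Outputs p' a e := by
  obtain ⟨n, hn⟩ := ho
  exact ⟨n, hn.trans (U.monotone a hpp le_rfl)⟩

omit [Fintype E] in
theorem MonotoneMachine.Outputs.prefix_or_prefix {U : MonotoneMachine A E} {p : List Bool}
    {a : List A} {e e' : List E} (ho : U.Outputs p a e) (ho' : U.Outputs p a e') :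
    e <+: e' ∨ e' <+: e := by
  obtain ⟨n, hn⟩ := ho
  obtain ⟨n', hn'⟩ := ho'
  exact List.prefix_or_prefix_of_prefix
    (hn.trans (U.monotone a List.prefix_rfl (le_max_left n n')))
    (hn'.trans (U.monotone a List.prefix_rfl (le_max_right n n')))

omit [Fintype E] in
theorem MonotoneMachine.Outputs.take {U : MonotoneMachine A E} {p : List Bool}
    {a : List A} {e : List E} (ho : U.Outputs p a e) (k : ℕ) :
    U.Outputs p (a.take k) (e.take k) := by
  obtain ⟨n, hn⟩ := ho
  exact ⟨n, by rw [U.chronological]; exact hn.take k⟩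

/-- Outputs on one random tape are comparable as prefixes, so different next percepts give disjoint
events. By chronology, each of these events lies in the event for `h`. -/
theorem MonotoneMachine.isChronologicalSemimeasure_mixture (U : MonotoneMachine A E) :
    IsChronologicalSemimeasure U.mixture where
  nonneg _ := measureReal_nonneg
  nil_le_one := measureReal_le_one
  sum_le h a := by
    unfold MonotoneMachine.mixture
    rw [← measureReal_biUnion_finset]
    · refine measureReal_mono ?_
      intro ω hω
      simp only [Set.mem_iUnion, Set.mem_ofPred_eq] at hω ⊢
      obtain ⟨e, -, k, hk⟩ := hω
      refine ⟨k, ?_⟩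
      simpa using hk.take h.length
    · intro e _ e' _ hee
      refine Set.disjoint_left.2 fun ω hω hω' => hee ?_
      obtain ⟨k, hk⟩ := hω
      obtain ⟨k', hk'⟩ := hω'
      simp only [List.map_append, List.map_singleton] at hk hk'
      have := (hk.mono (ofFn_prefix_ofFn ω (le_max_left k k'))).prefix_or_prefix
        (hk'.mono (ofFn_prefix_ofFn ω (le_max_right k k')))
      rcases this with this | this
      · simpa using this.eq_of_length (by simp)
      · simpa using (this.eq_of_length (by simp)).symm
    · exact fun e _ => measurableSet_outputs U _ _

/-- The cylinder is a product set with finitely many constrained coordinates, each a singleton of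
positive mass. -/
theorem coinFlips_cylinder_pos (c : List Bool) :
    0 < coinFlips.real {ω | (List.ofFn fun i : Fin c.length => ω i) = c} := by
  have hset : {ω : ℕ → Bool | (List.ofFn fun i : Fin c.length => ω i) = c} =
      Set.pi (Finset.range c.length) fun i => {c.getD i false} := by
    ext ω
    simp only [Set.mem_ofPred_eq, Set.mem_pi, Finset.coe_range, Set.mem_Iio, Set.mem_singleton_iff]
    constructor
    · intro hω i hi
      rw [List.getD_eq_getElem _ _ hi]
      have := List.getElem_of_eq hω (i := i) (by simpa using hi)
      simpa using this
    · intro hω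
      refine List.ext_getElem (by simp) fun i h1 h2 => ?_
      rw [List.getElem_ofFn, ← List.getD_eq_getElem _ false h2]
      exact hω i h2
  rw [hset, measureReal_def, ENNReal.toReal_pos_iff]
  refine ⟨?_, measure_lt_top _ _⟩
  rw [coinFlips, Measure.infinitePi_pi _ fun _ _ => measurableSet_singleton _]
  refine pos_iff_ne_zero.2 (Finset.prod_ne_zero_iff.2 fun i _ => ?_)
  rw [PMF.toMeasure_apply_singleton _ _ (measurableSet_singleton _)]
  simp

omit [Fintype E] in
theorem MonotoneMachine.cylinder_le_mixture {U : MonotoneMachine A E} {c : List Bool}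
    {h : History A E} (ho : U.Outputs c (h.map Prod.fst) (h.map Prod.snd)) :
    coinFlips.real {ω | (List.ofFn fun i : Fin c.length => ω i) = c} ≤ U.mixture h := by
  refine measureReal_mono fun ω hω => ⟨c.length, ?_⟩
  rwa [show (List.ofFn fun i : Fin c.length => ω i) = c from hω]

/-- A universal mixture is bounded below on the histories of the adversarial environment. -/
theorem exists_pos_le_of_universal [DecidableEq A] {ξ : History A E → ℝ}
    (hξ : (∃ U : MonotoneMachine A E, U.IsUniversal ∧ ξ = U.mixture) ∨
      (∃ w : environmentClass A E → ℝ, IsUniversalPrior w ∧ ξ = mixture w))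
    {π : Policy A E} (hπ : Computable π) (e₀ e₁ : E) :
    ∃ c, 0 < c ∧ ∀ h, adversaryHistory π e₀ e₁ (h.map Prod.fst) = h → c ≤ ξ h := by
  rcases hξ with ⟨U, hU, rfl⟩ | ⟨w, hw, rfl⟩
  · obtain ⟨c, hc⟩ := hU (adversaryMachine π e₀ e₁ hπ)
    refine ⟨_, coinFlips_cylinder_pos c, fun h hh => U.cylinder_le_mixture ?_⟩
    -- The adversarial machine ignores its program, so the simulation prefix `c` alone already
    -- produces the output.
    have := (hc [] (h.map Prod.fst) (h.map Prod.snd)).2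
      ⟨0, by simp only [adversaryMachine, hh]; exact List.prefix_rfl⟩
    simpa using this
  · classical
    let ν : environmentClass A E :=
      ⟨adversaryMeasure π e₀ e₁, adversaryMeasure_mem_environmentClass hπ⟩
    refine ⟨w ν, hw.pos ν, fun h hh => ?_⟩
    have := le_mixture hw ν h
    rwa [show (ν : History A E → ℝ) h = 1 from if_pos hh, mul_one] at this

theorem isChronologicalSemimeasure_of_universal {ξ : History A E → ℝ}
    (hξ : (∃ U : MonotoneMachine A E, U.IsUniversal ∧ ξ = U.mixture) ∨
      (∃ w : environmentClass A E → ℝ, IsUniversalPrior w ∧ ξ = mixture w)) :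
    IsChronologicalSemimeasure ξ := by
  rcases hξ with ⟨U, -, rfl⟩ | ⟨w, hw, rfl⟩
  · exact U.isChronologicalSemimeasure_mixture
  · exact AIXI.isChronologicalSemimeasure_mixture hw

/-- For every computable policy `π` there is a history at which `ξ` gives little weight to leaving
the branch of `e₀` under `π`, but gives more weight, by a factor, to the branch of `e₁` under a
constant policy. -/
theorem exists_history_of_computable [Nontrivial A] {ξ : History A E → ℝ}
    (hξ : (∃ U : MonotoneMachine A E, U.IsUniversal ∧ ξ = U.mixture) ∨
      (∃ w : environmentClass A E → ℝ, IsUniversalPrior w ∧ ξ = mixture w))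
    {π : Policy A E} (hπ : Computable π) (e₀ e₁ : E) {ρ : ℝ} (hρ : 0 < ρ) :
    ∃ (h : History A E) (b : A) (c δ : ℝ), 0 < ξ h ∧ δ < ρ * c ∧
      (∀ n, ξ h - ξ (extend π h (List.replicate n e₀)) ≤ δ) ∧
      ∀ n, c ≤ ξ (extend (fun _ => b) h (List.replicate n e₁)) := by
  classical
  have hs := isChronologicalSemimeasure_of_universal hξ
  obtain ⟨c, hc, hle⟩ := exists_pos_le_of_universal hξ hπ e₀ e₁
  set x : ℕ → ℝ := fun n => ξ (extend π [] (List.replicate n e₀)) with hx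
  have hxc : ∀ n, c ≤ x n := fun n => hle _ (congrArg Prod.fst (adversaryState_following n))
  have hbdd : BddBelow (Set.range x) := ⟨c, by rintro _ ⟨n, rfl⟩; exact hxc n⟩
  -- The infimum is the limit of the decreasing sequence `x`; `δ` is the gap left at time `n`, which
  -- bounds all later losses.
  obtain ⟨n, hn⟩ := exists_lt_of_ciInf_lt (lt_add_of_pos_right (iInf x) (mul_pos hρ hc))
  set h := extend π [] (List.replicate n e₀) with hh
  obtain ⟨b, hb⟩ := exists_ne (π h)
  refine ⟨h, b, c, x n - iInf x, hc.trans_le (hxc n), by linarith, fun k => ?_,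
    fun k => hle _ (adversaryHistory_deviating (adversaryState_following n) hb k)⟩
  rw [hh, ← extend_append, List.replicate_append_replicate]
  exact sub_le_sub_left (ciInf_le hbdd _) _

end Mixtures

end AIXI

end

/-! ### The contradiction with optimality, for lifetimes and for discounting. -/

theorem mainTheorem2 {A E : Type*} [Finite A] [Nontrivial A] [Primcodable A]
    [Fintype E] [Primcodable E]
    (r : E → ℝ) (hr : ∀ e, r e ∈ Set.Icc (0 : ℝ) 1)
    (hr_zero : ∃ e, r e = 0) (hr_pos : ∃ e, 0 < r e)
    (ξ : AIXI.History A E → ℝ)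
    (hξ : (∃ U : AIXI.MonotoneMachine A E, U.IsUniversal ∧ ξ = U.mixture) ∨
      (∃ w : AIXI.environmentClass A E → ℝ, AIXI.IsUniversalPrior w ∧ ξ = AIXI.mixture w)) :
    (¬ ∃ π : ℕ → AIXI.Policy A E, Computable₂ π ∧ AIXI.IsAIXILT r ξ π) ∧
    (¬ ∃ π : ℕ → AIXI.Policy A E, Computable₂ π ∧ AIXI.IsAIXILTUpTo r ξ π) ∧
    (∀ γ : ℕ → ℝ, AIXI.IsDiscount γ →
      ¬ ∃ π : AIXI.Policy A E, Computable π ∧ AIXI.IsAIXIDC γ r ξ π) := by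
  obtain ⟨e₀, he₀⟩ := hr_zero
  obtain ⟨e₁, he₁⟩ := hr_pos
  have hs := AIXI.isChronologicalSemimeasure_of_universal hξ
  -- The diagonal policy: at `h` the next action has time index `h.length + 1`, so with this
  -- lifetime it is the last that counts.
  have last : ∀ π : ℕ → AIXI.Policy A E, Computable₂ π →
      Computable fun h : AIXI.History A E => π (h.length + 1) h := fun π hπ =>
    hπ.comp (Computable.succ.comp Computable.list_length) Computable.id
  refine ⟨?_, ?_, ?_⟩
  · rintro ⟨π, hπ, hopt⟩
    obtain ⟨h, b, c, δ, hpos, hδ, hstay, hleave⟩ :=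
      AIXI.exists_history_of_computable hξ (last π hπ) e₀ e₁ he₁
    have hγ := AIXI.lifetimeDiscount_nonneg (h.length + 1)
    have hγs := AIXI.summable_lifetimeDiscount (h.length + 1)
    have hΓ := AIXI.discountNorm_lifetimeDiscount_self (h.length + 1)
    have h1 := AIXI.value_last_step_le (π := π (h.length + 1)) (h := h) hs hr he₀
    have h2 := AIXI.le_value hs hγ hγs hr (hΓ.symm ▸ one_pos) hleave
    have h3 := (hopt (h.length + 1)).le (π' := fun _ => b) h
      fun π' => AIXI.value_le_one hs hγ hγs hr he₀
    -- `hstay` concerns the diagonal policy, but for a single step from `h` it takes the same action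
    -- as `π (h.length + 1)`.
    have h4 := h2.trans (h3.trans (h1.trans
      (div_le_div_of_nonneg_right (hstay 1) hpos.le)))
    rw [← mul_div_assoc, div_le_div_iff_of_pos_right hpos] at h4
    exact absurd h4 (not_le.2 hδ)
  · rintro ⟨π, hπ, hopt⟩
    obtain ⟨h, b, c, δ, hpos, hδ, hstay, hleave⟩ :=
      AIXI.exists_history_of_computable hξ (last π hπ) e₀ e₁ he₁
    have hγ := AIXI.lifetimeDiscount_nonneg (h.length + 1)
    have hγs := AIXI.summable_lifetimeDiscount (h.length + 1)
    have hΓ := AIXI.discountNorm_lifetimeDiscount_self (h.length + 1)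
    have h1 := AIXI.partialValue_le (π := π (h.length + 1)) (h := h) hs hγ hγs hr he₀ 1
    have h2 := AIXI.le_partialValue (π := fun _ => b) (h := h) hs hγ hr e₁ 1
    have h3 := (hopt (h.length + 1)).le (π' := fun _ => b) (b := 1) h fun π' => by
      rw [AIXI.valueUpTo_last_step, ← hΓ]
      exact AIXI.partialValue_le_discountNorm hs hγ hγs hr he₀ 1
    rw [AIXI.valueUpTo_last_step, AIXI.valueUpTo_last_step] at h3
    rw [hΓ, one_mul] at h1
    rw [Finset.sum_range_one, AIXI.lifetimeDiscount, if_pos (by simp), one_mul] at h2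
    have h4 := h2.trans (h3.trans (h1.trans
      (div_le_div_of_nonneg_right (hstay 1) hpos.le)))
    rw [← mul_div_assoc, div_le_div_iff_of_pos_right hpos] at h4
    exact absurd ((mul_le_mul_of_nonneg_left (hleave 1) he₁.le).trans h4) (not_le.2 hδ)
  · rintro γ hγ ⟨π, hπ, hopt⟩
    obtain ⟨h, b, c, δ, hpos, hδ, hstay, hleave⟩ :=
      AIXI.exists_history_of_computable hξ hπ e₀ e₁ he₁
    have hδ0 : 0 ≤ δ := by simpa [AIXI.extend] using hstay 0
    have h1 : AIXI.value γ r ξ π h ≤ δ / ξ h :=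
      AIXI.value_le_of_eventually hs hγ.nonneg hγ.summable hr (div_nonneg hδ0 hpos.le)
        (Eventually.of_forall fun n =>
          (AIXI.partialValue_le hs hγ.nonneg hγ.summable hr he₀ n).trans
            (mul_le_mul_of_nonneg_left (div_le_div_of_nonneg_right (hstay n) hpos.le)
              (hγ.norm_pos _).le))
    have h2 := AIXI.le_value hs hγ.nonneg hγ.summable hr (hγ.norm_pos _) hleave
    have h3 := hopt.le (π' := fun _ => b) h
      fun π' => AIXI.value_le_one hs hγ.nonneg hγ.summable hr he₀
    have h4 := h2.trans (h3.trans h1)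
    rw [← mul_div_assoc, div_le_div_iff_of_pos_right hpos] at h4
    exact absurd h4 (not_le.2 hδ)
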